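/- Let $A$ and $B$ be C*-algebras, $M_1$ a Hilbert $A$-module and $M_2$ a Hilbert $B$-module. Let $A\otimes B$ be the minimal (spatial) tensor product, and let $M_1\otimes M_2$ be the external tensor product, i.e. the Hilbert $A\otimes B$-module obtained by completing the algebraic tensor product $M_1\odot M_2$ in the norm induced by the $A\otimes B$-valued inner product determined by $\langle x\otimes y,\,x'\otimes y'\rangle=\langle x,x'\rangle\otimes\langle y,y'\rangle$. For a Hilbert C*-module $E$ and a closed submodule $X\subseteq E$, write $X\subset\subset E$ if $X$ and $E$ are countably generated and there is a compact self-adjoint endomorphism $b$ of $E$ with $b x=x$ for all $x\in X$; here the compact endomorphisms are the norm closure of the linear span of the operators $z\mapsto x\langle y,z\rangle$ with $x,y\in E$. Call $E$ a compact element if $E\subset\subset E$. If $M_1$ and $M_2$ are compact elements, then the Hilbert $A\otimes B$-module $M_1\otimes M_2$ is a compact element. -/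

import Mathlib

set_option linter.unusedSectionVars false

noncomputable section

open scoped TensorProduct ComplexOrder InnerProductSpace ENNReal
open UniformSpace

universe u v

/-- The Hilbert space tensor product `H ⊗ K`: the completion of the algebraic tensor product. -/
def HilbertTensor (H : Type u) (K : Type v) [NormedAddCommGroup H] [InnerProductSpace ℂ H]
    [NormedAddCommGroup K] [InnerProductSpace ℂ K] : Type (max u v) :=
  Completion (H ⊗[ℂ] K)

namespace HilbertTensor

variable {H : Type u} {K : Type v} [NormedAddCommGroup H] [InnerProductSpace ℂ H]
    [NormedAddCommGroup K] [InnerProductSpace ℂ K]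

instance : NormedAddCommGroup (HilbertTensor H K) :=
  inferInstanceAs (NormedAddCommGroup (Completion (H ⊗[ℂ] K)))
instance : InnerProductSpace ℂ (HilbertTensor H K) :=
  inferInstanceAs (InnerProductSpace ℂ (Completion (H ⊗[ℂ] K)))
instance : CompleteSpace (HilbertTensor H K) :=
  inferInstanceAs (CompleteSpace (Completion (H ⊗[ℂ] K)))

/-- The canonical isometric embedding of the algebraic tensor product. -/
def incl : H ⊗[ℂ] K →ₗᵢ[ℂ] HilbertTensor H K := Completion.toComplₗᵢ

theorem denseRange_incl : DenseRange (incl (H := H) (K := K)) := Completion.denseRange_coe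

@[elab_as_elim]
theorem induction_on {p : HilbertTensor H K → Prop} (ξ : HilbertTensor H K)
    (hp : IsClosed {x | p x}) (h : ∀ t : H ⊗[ℂ] K, p (incl t)) : p ξ :=
  Completion.induction_on ξ hp h

theorem inner_incl_tmul (x x' : H) (y y' : K) :
    ⟪incl (x ⊗ₜ[ℂ] y), incl (x' ⊗ₜ[ℂ] y')⟫_ℂ = ⟪x, x'⟫_ℂ * ⟪y, y'⟫_ℂ := by
  rw [LinearIsometry.inner_map_map, TensorProduct.inner_tmul]

theorem ext_op {S T : HilbertTensor H K →L[ℂ] HilbertTensor H K}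
    (h : ∀ x y, S (incl (x ⊗ₜ[ℂ] y)) = T (incl (x ⊗ₜ[ℂ] y))) : S = T := by
  ext ξ
  induction ξ using induction_on with
  | hp => exact isClosed_eq S.continuous T.continuous
  | h ξ =>
    induction ξ with
    | zero => simp
    | tmul x y => exact h x y
    | add x y hx hy => simp only [map_add, hx, hy]

/-- The bounded operator `S ⊗ T` on `H ⊗ K`. -/
def op (S : H →L[ℂ] H) (T : K →L[ℂ] K) : HilbertTensor H K →L[ℂ] HilbertTensor H K :=
  (TensorProduct.mapL S T).completion

@[simp]
theorem op_incl_tmul (S : H →L[ℂ] H) (T : K →L[ℂ] K) (x : H) (y : K) :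
    op S T (incl (x ⊗ₜ[ℂ] y)) = incl (S x ⊗ₜ[ℂ] T y) := by
  have := (TensorProduct.mapL S T).completion_apply_coe (x ⊗ₜ[ℂ] y)
  rw [TensorProduct.mapL_tmul] at this
  exact this

theorem norm_op_le (S : H →L[ℂ] H) (T : K →L[ℂ] K) : ‖op S T‖ ≤ ‖S‖ * ‖T‖ := by
  refine ContinuousLinearMap.opNorm_le_bound _ (by positivity) fun ξ => ?_
  induction ξ using induction_on with
  | hp => exact isClosed_le (by fun_prop) (by fun_prop)
  | h ξ =>
    have h1 : op S T (incl ξ) = incl (TensorProduct.mapL S T ξ) :=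
      (TensorProduct.mapL S T).completion_apply_coe ξ
    rw [h1, LinearIsometry.norm_map, LinearIsometry.norm_map]
    refine (ContinuousLinearMap.le_opNorm _ _).trans ?_
    gcongr
    exact TensorProduct.norm_mapL_le _ _

theorem op_mul (S S' : H →L[ℂ] H) (T T' : K →L[ℂ] K) :
    op (S * S') (T * T') = op S T * op S' T' :=
  ext_op fun x y => by simp

theorem op_star [CompleteSpace H] [CompleteSpace K] (S : H →L[ℂ] H) (T : K →L[ℂ] K) :
    op (star S) (star T) = star (op S T) := by
  rw [ContinuousLinearMap.star_eq_adjoint (op S T)]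
  refine (ContinuousLinearMap.eq_adjoint_iff _ _).mpr fun ξ η => ?_
  induction ξ using induction_on with
  | hp => apply isClosed_eq <;> fun_prop
  | h ξ =>
    induction η using induction_on with
    | hp => apply isClosed_eq <;> fun_prop
    | h η =>
      induction ξ with
      | zero => simp
      | add ξ ξ' h h' => simp only [map_add, inner_add_left, h, h']
      | tmul x y =>
        induction η with
        | zero => simp
        | add η η' h h' => simp only [map_add, inner_add_right, h, h']
        | tmul x' y' =>
          simp [ContinuousLinearMap.star_eq_adjoint,
            ContinuousLinearMap.adjoint_inner_left]

/-- `(S, T) ↦ S ⊗ T` as a bilinear map. -/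
def opBilin : (H →L[ℂ] H) →ₗ[ℂ] (K →L[ℂ] K) →ₗ[ℂ]
    (HilbertTensor H K →L[ℂ] HilbertTensor H K) :=
  LinearMap.mk₂ ℂ op
    (fun S S' T => ext_op fun x y => by simp [TensorProduct.add_tmul])
    (fun c S T => ext_op fun x y => by
      rw [op_incl_tmul, smul_apply, ← TensorProduct.smul_tmul', map_smul,
        smul_apply, op_incl_tmul])
    (fun S T T' => ext_op fun x y => by simp [TensorProduct.tmul_add])
    (fun c S T => ext_op fun x y => by simp)

variable [CompleteSpace H] [CompleteSpace K]
  {A B : Type*} [NonUnitalCStarAlgebra A] [NonUnitalCStarAlgebra B]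

/-- The representation `π ⊗ ρ` of the algebraic tensor product `A ⊙ B` on `H ⊗ K`. -/
def rep (π : A →⋆ₙₐ[ℂ] (H →L[ℂ] H)) (ρ : B →⋆ₙₐ[ℂ] (K →L[ℂ] K)) :
    A ⊗[ℂ] B →⋆ₙₐ[ℂ] (HilbertTensor H K →L[ℂ] HilbertTensor H K) :=
  let L : A ⊗[ℂ] B →ₗ[ℂ] (HilbertTensor H K →L[ℂ] HilbertTensor H K) :=
    TensorProduct.lift (opBilin.compl₁₂ (π : A →ₗ[ℂ] (H →L[ℂ] H)) (ρ : B →ₗ[ℂ] (K →L[ℂ] K)))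
  have hL : ∀ a b, L (a ⊗ₜ b) = op (π a) (ρ b) := fun a b => rfl
  { L with
    map_zero' := map_zero L
    map_mul' := fun s t => by
      change L (s * t) = L s * L t
      induction s with
      | zero => simp
      | add s s' hs hs' => simp only [add_mul, map_add, hs, hs']
      | tmul a b =>
        induction t with
        | zero => simp
        | add t t' ht ht' => simp only [mul_add, map_add, ht, ht']
        | tmul a' b' =>
          rw [Algebra.TensorProduct.tmul_mul_tmul, hL, hL, hL, map_mul, map_mul, op_mul]
    map_star' := fun s => by
      change L (star s) = star (L s)
      induction s with
      | zero => simp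
      | add s s' hs hs' => simp only [star_add, map_add, hs, hs']
      | tmul a b => rw [TensorProduct.star_tmul, hL, hL, map_star, map_star, op_star] }

theorem rep_tmul (π : A →⋆ₙₐ[ℂ] (H →L[ℂ] H)) (ρ : B →⋆ₙₐ[ℂ] (K →L[ℂ] K)) (a : A) (b : B) :
    rep π ρ (a ⊗ₜ b) = op (π a) (ρ b) := rfl

end HilbertTensor

section Family

variable {I : Type*} {F : I → Type*} [∀ i, NonUnitalCStarAlgebra (F i)]

/-- The C⋆-algebra of bounded families `(x i)` with `x i ∈ F i`. -/
def BddFamily (F : I → Type*) [∀ i, NonUnitalCStarAlgebra (F i)] : Type _ := lp F ∞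

instance : NonUnitalCStarAlgebra (BddFamily F) :=
  inferInstanceAs (NonUnitalCStarAlgebra (lp F ∞))

/-- The member with index `i` of a family. -/
def BddFamily.proj (i : I) : BddFamily F →⋆ₙₐ[ℂ] F i where
  toFun x := x.1 i
  map_smul' _ _ := rfl
  map_zero' := rfl
  map_add' _ _ := rfl
  map_mul' _ _ := rfl
  map_star' _ := rfl

theorem BddFamily.ext {x y : BddFamily F} (h : ∀ i, proj i x = proj i y) : x = y :=
  lp.ext (funext h)

/-- A pointwise bounded family of ⋆-homomorphisms, as one ⋆-homomorphism. -/
def BddFamily.lift {D : Type*} [NonUnitalRing D] [Module ℂ D] [Star D]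
    (φ : ∀ i, D →⋆ₙₐ[ℂ] F i) (h : ∀ d, ∃ C : ℝ, ∀ i, ‖φ i d‖ ≤ C) :
    D →⋆ₙₐ[ℂ] BddFamily F where
  toFun d := ⟨fun i => φ i d, by
    obtain ⟨C, hC⟩ := h d
    refine memℓp_infty ⟨C, ?_⟩
    rintro _ ⟨i, rfl⟩
    exact hC i⟩
  map_smul' c s := ext fun i => map_smul (φ i) c s
  map_zero' := ext fun i => map_zero (φ i)
  map_add' s t := ext fun i => map_add (φ i) s t
  map_mul' s t := ext fun i => map_mul (φ i) s t
  map_star' s := ext fun i => map_star (φ i) s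

end Family

section SpatialTensor

variable (A : Type u) (B : Type v)
  [NonUnitalCStarAlgebra A] [PartialOrder A] [StarOrderedRing A]
  [NonUnitalCStarAlgebra B] [PartialOrder B] [StarOrderedRing B]

variable {A B} in
/-- The tensor product `π_f ⊗ π_g` of the GNS representations of two positive functionals. -/
def gnsRep (f : A →ₚ[ℂ] ℂ) (g : B →ₚ[ℂ] ℂ) : A ⊗[ℂ] B →⋆ₙₐ[ℂ]
    (HilbertTensor f.GNS g.GNS →L[ℂ] HilbertTensor f.GNS g.GNS) :=
  HilbertTensor.rep f.gnsNonUnitalStarAlgHom g.gnsNonUnitalStarAlgHom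

variable {A B} in
theorem gnsRep_bounded (s : A ⊗[ℂ] B) : ∃ C : ℝ, ∀ (f : A →ₚ[ℂ] ℂ) (g : B →ₚ[ℂ] ℂ),
    ‖gnsRep f g s‖ ≤ C := by
  induction s with
  | zero => exact ⟨0, fun f g => by rw [map_zero, norm_zero]⟩
  | tmul a b =>
    refine ⟨‖a‖ * ‖b‖, fun f g => (HilbertTensor.norm_op_le _ _).trans ?_⟩
    gcongr
    · exact NonUnitalStarAlgHom.norm_apply_le f.gnsNonUnitalStarAlgHom a
    · exact NonUnitalStarAlgHom.norm_apply_le g.gnsNonUnitalStarAlgHom b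
  | add s s' hs hs' =>
    obtain ⟨C, hC⟩ := hs
    obtain ⟨C', hC'⟩ := hs'
    refine ⟨C + C', fun f g => ?_⟩
    rw [map_add]
    refine (norm_add_le _ _).trans ?_
    have h1 := hC f g
    have h2 := hC' f g
    gcongr

/-- The C⋆-algebra of bounded families of operators on the spaces `H_f ⊗ H_g`, indexed by the
pairs of positive functionals on `A` and on `B`. -/
abbrev BlockOp : Type (max u v) :=
  BddFamily (fun p : (A →ₚ[ℂ] ℂ) × (B →ₚ[ℂ] ℂ) =>
    (HilbertTensor p.1.GNS p.2.GNS →L[ℂ] HilbertTensor p.1.GNS p.2.GNS))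

/-- The tensor product of the universal representations of `A` and `B`, on the algebraic tensor
product. -/
def universalRep : A ⊗[ℂ] B →⋆ₙₐ[ℂ] BlockOp A B :=
  BddFamily.lift (fun p => gnsRep p.1 p.2) fun s => by
    obtain ⟨C, hC⟩ := gnsRep_bounded s
    exact ⟨C, fun p => hC p.1 p.2⟩

/-- The minimal (spatial) tensor product `A ⊗ B`: the norm closure of the image of the algebraic
tensor product under the tensor product of the universal representations. -/
def MinTensor : Type (max u v) :=
  (NonUnitalStarAlgHom.range (universalRep A B)).topologicalClosure

namespace MinTensor

instance : NonUnitalCStarAlgebra (MinTensor A B) :=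
  haveI : IsClosed ((NonUnitalStarAlgHom.range (universalRep A B)).topologicalClosure :
    Set (BlockOp A B)) := NonUnitalStarSubalgebra.isClosed_topologicalClosure _
  inferInstanceAs (NonUnitalCStarAlgebra
    (NonUnitalStarAlgHom.range (universalRep A B)).topologicalClosure)

instance : PartialOrder (MinTensor A B) := CStarAlgebra.spectralOrder _

instance : StarOrderedRing (MinTensor A B) := CStarAlgebra.spectralOrderedRing _

/-- The canonical map `A ⊙ B → A ⊗ B`. -/
def ι : A ⊗[ℂ] B →⋆ₙₐ[ℂ] MinTensor A B where
  toFun s := ⟨universalRep A B s, NonUnitalStarSubalgebra.le_topologicalClosure _ ⟨s, rfl⟩⟩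
  map_smul' c s := Subtype.ext (map_smul (universalRep A B) c s)
  map_zero' := Subtype.ext (map_zero (universalRep A B))
  map_add' s t := Subtype.ext (map_add (universalRep A B) s t)
  map_mul' s t := Subtype.ext (map_mul (universalRep A B) s t)
  map_star' s := Subtype.ext (map_star (universalRep A B) s)

theorem denseRange_ι : DenseRange (ι A B) := by
  intro x
  refine (closure_subtype (X := BlockOp A B)
    (p := (· ∈ (NonUnitalStarAlgHom.range (universalRep A B)).topologicalClosure))
    (x := x) (s := Set.range (ι A B))).2 ?_
  refine closure_mono ?_ x.2
  rintro _ ⟨s, rfl⟩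
  exact ⟨ι A B s, ⟨s, rfl⟩, rfl⟩

variable {A B} in
/-- The restriction of an element of `A ⊗ B` to the block `H_f ⊗ H_g`. -/
def block (f : A →ₚ[ℂ] ℂ) (g : B →ₚ[ℂ] ℂ) : MinTensor A B →⋆ₙₐ[ℂ]
    (HilbertTensor f.GNS g.GNS →L[ℂ] HilbertTensor f.GNS g.GNS) where
  toFun x := BddFamily.proj (f, g) x.1
  map_smul' c x := map_smul (BddFamily.proj (f, g)) c x.1
  map_zero' := map_zero (BddFamily.proj (f, g))
  map_add' x y := map_add (BddFamily.proj (f, g)) x.1 y.1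
  map_mul' x y := map_mul (BddFamily.proj (f, g)) x.1 y.1
  map_star' x := map_star (BddFamily.proj (f, g)) x.1

variable {A B} in
theorem block_ι (f : A →ₚ[ℂ] ℂ) (g : B →ₚ[ℂ] ℂ) (s : A ⊗[ℂ] B) :
    block f g (ι A B s) = gnsRep f g s := rfl

variable {A B} in
theorem ext_block {x y : MinTensor A B} (h : ∀ (f : A →ₚ[ℂ] ℂ) (g : B →ₚ[ℂ] ℂ), block f g x = block f g y) : x = y :=
  Subtype.ext (BddFamily.ext fun p => h p.1 p.2)

variable {A B} in
theorem nonneg_of_block {x : MinTensor A B} (h : ∀ (f : A →ₚ[ℂ] ℂ) (g : B →ₚ[ℂ] ℂ), 0 ≤ block f g x) : 0 ≤ x := by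
  have hx : IsSelfAdjoint x := ext_block fun f g => by
    rw [map_star]
    exact (IsSelfAdjoint.of_nonneg (h f g))
  rw [← CFC.negPart_eq_zero_iff x hx]
  refine ext_block fun f g => ?_
  rw [map_zero, CFC.negPart_def, NonUnitalStarAlgHomClass.map_cfcₙ (block f g) _ x,
    ← CFC.negPart_def, CFC.negPart_eq_zero_iff _ (IsSelfAdjoint.of_nonneg (h f g))]
  exact h f g

end MinTensor
end SpatialTensor

section Positivity

/-- A positive semidefinite form on a vector space is induced by a map to an inner product
space. -/
theorem exists_innerProductSpace_of_form {V : Type u} [AddCommGroup V] [Module ℂ V]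
    (q : V →ₗ⋆[ℂ] V →ₗ[ℂ] ℂ) (hs : ∀ x y, star (q y x) = q x y) (hq : ∀ x, 0 ≤ q x x) :
    ∃ (H : Type u) (_ : NormedAddCommGroup H) (_ : InnerProductSpace ℂ H) (κ : V →ₗ[ℂ] H),
      ∀ x y, ⟪κ x, κ y⟫_ℂ = q x y := by
  let c : PreInnerProductSpace.Core ℂ V :=
    { inner := fun x y => q x y
      conj_inner_symm := hs
      re_inner_nonneg := fun x => (Complex.le_def.1 (hq x)).1
      add_left := fun x y z => by simp
      smul_left := fun x y r => by simp }
  let : SeminormedAddCommGroup V := InnerProductSpace.Core.toSeminormedAddCommGroup (c := c)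
  let : InnerProductSpace ℂ V := InnerProductSpace.ofCore c
  exact ⟨Completion V, inferInstance, inferInstance, (Completion.toComplₗᵢ (𝕜 := ℂ)).toLinearMap,
    fun x y => Completion.inner_coe x y⟩

variable {A : Type u} {B : Type v}
  [NonUnitalCStarAlgebra A] [PartialOrder A] [StarOrderedRing A]
  [NonUnitalCStarAlgebra B] [PartialOrder B] [StarOrderedRing B]

/-- The functional `f ⊗ g` on the algebraic tensor product. -/
def tensorFunctional (f : A →ₚ[ℂ] ℂ) (g : B →ₚ[ℂ] ℂ) : A ⊗[ℂ] B →ₗ[ℂ] ℂ :=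
  TensorProduct.lift ((LinearMap.mul ℂ ℂ).compl₁₂ f.toLinearMap g.toLinearMap)

theorem tensorFunctional_tmul (f : A →ₚ[ℂ] ℂ) (g : B →ₚ[ℂ] ℂ) (a : A) (b : B) :
    tensorFunctional f g (a ⊗ₜ b) = f a * g b := rfl

/-- The dense image of `A ⊙ B` in the tensor product of two GNS spaces. -/
def gnsVector (f : A →ₚ[ℂ] ℂ) (g : B →ₚ[ℂ] ℂ) : A ⊗[ℂ] B →ₗ[ℂ] HilbertTensor f.GNS g.GNS :=
  HilbertTensor.incl.toLinearMap ∘ₗ TensorProduct.map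
    ((Completion.toComplₗᵢ (𝕜 := ℂ) (E := f.PreGNS)).toLinearMap ∘ₗ f.toPreGNS.toLinearMap)
    ((Completion.toComplₗᵢ (𝕜 := ℂ) (E := g.PreGNS)).toLinearMap ∘ₗ g.toPreGNS.toLinearMap)

theorem gnsVector_tmul (f : A →ₚ[ℂ] ℂ) (g : B →ₚ[ℂ] ℂ) (a : A) (b : B) :
    gnsVector f g (a ⊗ₜ b) =
      HilbertTensor.incl ((f.toPreGNS a : f.GNS) ⊗ₜ[ℂ] (g.toPreGNS b : g.GNS)) := rfl

theorem inner_gnsVector (f : A →ₚ[ℂ] ℂ) (g : B →ₚ[ℂ] ℂ) (t s t' : A ⊗[ℂ] B) :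
    ⟪gnsVector f g t, gnsRep f g s (gnsVector f g t')⟫_ℂ =
      tensorFunctional f g (star t * (s * t')) := by
  induction t with
  | zero => rw [star_zero, zero_mul, map_zero, map_zero, inner_zero_left]
  | add t₁ t₂ h₁ h₂ => rw [map_add, inner_add_left, h₁, h₂, star_add, add_mul, map_add]
  | tmul a b =>
    induction t' with
    | zero => rw [map_zero, map_zero, inner_zero_right, mul_zero, mul_zero, map_zero]
    | add t₁ t₂ h₁ h₂ =>
      rw [map_add, map_add, inner_add_right, h₁, h₂, mul_add, mul_add, map_add]
    | tmul a' b' =>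
      induction s with
      | zero => rw [map_zero, zero_mul, mul_zero, map_zero]; simp
      | add s₁ s₂ h₁ h₂ =>
        rw [map_add, add_mul, mul_add, map_add, ← h₁, ← h₂, add_apply, inner_add_right]
      | tmul c d =>
        have h : gnsRep f g (c ⊗ₜ d) (gnsVector f g (a' ⊗ₜ b')) =
            gnsVector f g ((c * a') ⊗ₜ (d * b')) := by
          rw [gnsVector_tmul, gnsVector_tmul, gnsRep, HilbertTensor.rep_tmul,
            HilbertTensor.op_incl_tmul, PositiveLinearMap.gnsNonUnitalStarAlgHom_apply_coe,
            PositiveLinearMap.gnsNonUnitalStarAlgHom_apply_coe]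
          rfl
        rw [h, gnsVector_tmul, gnsVector_tmul, HilbertTensor.inner_incl_tmul,
          Completion.inner_coe, Completion.inner_coe, PositiveLinearMap.preGNS_inner_def,
          PositiveLinearMap.preGNS_inner_def, TensorProduct.star_tmul,
          Algebra.TensorProduct.tmul_mul_tmul, Algebra.TensorProduct.tmul_mul_tmul,
          tensorFunctional_tmul]
        rfl

theorem denseRange_gnsVector (f : A →ₚ[ℂ] ℂ) (g : B →ₚ[ℂ] ℂ) : DenseRange (gnsVector f g) := by
  let W : Submodule ℂ (HilbertTensor f.GNS g.GNS) :=
    (LinearMap.range (gnsVector f g)).topologicalClosure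
  have hcl : IsClosed (W : Set (HilbertTensor f.GNS g.GNS)) :=
    Submodule.isClosed_topologicalClosure _
  suffices h : ∀ ξ, ξ ∈ W from fun ξ => h ξ
  have hcont : Continuous fun p : f.GNS × g.GNS => HilbertTensor.incl (p.1 ⊗ₜ[ℂ] p.2) :=
    HilbertTensor.incl.continuous.comp TensorProduct.continuous_tmul
  intro ξ
  induction ξ using HilbertTensor.induction_on with
  | hp => exact hcl
  | h ξ =>
    induction ξ with
    | zero => rw [map_zero]; exact W.zero_mem
    | add x y hx hy => rw [map_add]; exact W.add_mem hx hy
    | tmul x y =>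
      induction x, y using Completion.induction_on₂ with
      | hp => exact hcl.preimage hcont
      | ih a b =>
        exact Submodule.le_topologicalClosure _ ⟨f.ofPreGNS a ⊗ₜ g.ofPreGNS b, rfl⟩

/-- Positivity in the minimal tensor product, tested on product functionals. -/
theorem MinTensor.ι_nonneg {s : A ⊗[ℂ] B} (hs : star s = s)
    (h : ∀ (f : A →ₚ[ℂ] ℂ) (g : B →ₚ[ℂ] ℂ) (t : A ⊗[ℂ] B),
      0 ≤ tensorFunctional f g (star t * (s * t))) : 0 ≤ ι A B s := by
  refine nonneg_of_block fun f g => ?_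
  rw [block_ι, ContinuousLinearMap.nonneg_iff_isPositive, ContinuousLinearMap.isPositive_def']
  refine ⟨?_, fun ξ => ?_⟩
  · rw [IsSelfAdjoint, ← map_star, hs]
  · rw [ContinuousLinearMap.reApplyInnerSelf_apply]
    induction ξ using (denseRange_gnsVector f g).induction_on with
    | hp => exact isClosed_le (by fun_prop) (by fun_prop)
    | ih t =>
      rw [← inner_re_symm, inner_gnsVector]
      exact (Complex.le_def.1 (h f g t)).1

end Positivity

section HilbertModule

universe w w'

variable {A : Type u} {M : Type w} [NonUnitalCStarAlgebra A] [PartialOrder A] [StarOrderedRing A]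
  [NormedAddCommGroup M] [NormedSpace ℂ M] [SMul A M] [CStarModule A M]

namespace HilbertModule

variable (A) in
theorem ext_inner {x y : M} (h : ∀ z : M, inner A z x = inner A z y) : x = y := by
  have h0 : inner A (x - y) (x - y) = 0 := by
    rw [CStarModule.inner_sub_right, h, sub_self]
  exact sub_eq_zero.1 (CStarModule.inner_self.1 h0)

/-- The action of `A` on a Hilbert `A`-module as a bilinear map. -/
def act : A →ₗ[ℂ] M →ₗ[ℂ] M :=
  LinearMap.mk₂ ℂ (fun a x => a • x)
    (fun a b x => ext_inner A fun z => by simp [add_mul])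
    (fun c a x => ext_inner A fun z => by simp [smul_mul_assoc])
    (fun a x y => ext_inner A fun z => by simp [mul_add])
    (fun c a x => ext_inner A fun z => by simp [mul_smul_comm])

theorem norm_smul_le (a : A) (x : M) : ‖a • x‖ ≤ ‖a‖ * ‖x‖ := by
  rw [← sq_le_sq₀ (norm_nonneg _) (by positivity), CStarModule.norm_sq_eq A, mul_pow,
    CStarModule.norm_sq_eq A (x := x), CStarModule.inner_op_smul_right, CStarModule.inner_op_smul_left]
  calc ‖a * (inner A x x * star a)‖ ≤ ‖a‖ * (‖inner A x x‖ * ‖star a‖) :=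
        (norm_mul_le _ _).trans (by gcongr; exact norm_mul_le _ _)
    _ = ‖a‖ ^ 2 * ‖inner A x x‖ := by rw [norm_star]; ring

end HilbertModule

end HilbertModule

section ExternalTensor

universe w w'

/-- The algebraic tensor product `M ⊙ N` of a Hilbert `A`-module and a Hilbert `B`-module. -/
def AlgTensor (_A : Type u) (_B : Type v) (M : Type w) (N : Type w')
    [AddCommGroup M] [Module ℂ M] [AddCommGroup N] [Module ℂ N] : Type (max w w') :=
  M ⊗[ℂ] N

variable (A : Type u) (B : Type v) (M : Type w) (N : Type w')
  [NonUnitalCStarAlgebra A] [PartialOrder A] [StarOrderedRing A]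
  [NonUnitalCStarAlgebra B] [PartialOrder B] [StarOrderedRing B]
  [NormedAddCommGroup M] [NormedSpace ℂ M] [SMul A M] [CStarModule A M]
  [NormedAddCommGroup N] [NormedSpace ℂ N] [SMul B N] [CStarModule B N]

namespace AlgTensor

instance : AddCommGroup (AlgTensor A B M N) := inferInstanceAs (AddCommGroup (M ⊗[ℂ] N))
instance : Module ℂ (AlgTensor A B M N) := inferInstanceAs (Module ℂ (M ⊗[ℂ] N))

/-- The `A ⊙ B`-valued form with `⟨x ⊗ y, x' ⊗ y'⟩ = ⟨x, x'⟩ ⊗ ⟨y, y'⟩`. -/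
def form : AlgTensor A B M N →ₗ⋆[ℂ] AlgTensor A B M N →ₗ[ℂ] A ⊗[ℂ] B :=
  TensorProduct.map₂ (CStarModule.innerₛₗ (A := A) (E := M))
    (CStarModule.innerₛₗ (A := B) (E := N))

/-- The action of `A ⊙ B` with `(a ⊗ b) • (x ⊗ y) = (a • x) ⊗ (b • y)`. -/
def act : A ⊗[ℂ] B →ₗ[ℂ] AlgTensor A B M N →ₗ[ℂ] AlgTensor A B M N :=
  TensorProduct.map₂ (HilbertModule.act (A := A) (M := M)) (HilbertModule.act (A := B) (M := N))

variable {A B M N}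

/-- The elementary tensor `x ⊗ y`. -/
def tmul (x : M) (y : N) : AlgTensor A B M N := x ⊗ₜ[ℂ] y

theorem form_tmul (x x' : M) (y y' : N) :
    form A B M N (tmul x y) (tmul x' y') = inner A x x' ⊗ₜ[ℂ] inner B y y' := rfl

theorem act_tmul (a : A) (b : B) (x : M) (y : N) :
    act A B M N (a ⊗ₜ b) (tmul x y) = tmul (a • x) (b • y) := rfl

@[elab_as_elim]
theorem induction_on {p : AlgTensor A B M N → Prop} (z : AlgTensor A B M N) (zero : p 0)
    (tmul : ∀ x y, p (tmul x y)) (add : ∀ z w, p z → p w → p (z + w)) : p z :=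
  TensorProduct.induction_on z zero tmul add

theorem star_form (z w : AlgTensor A B M N) :
    star (form A B M N z w) = form A B M N w z := by
  induction z using induction_on with
  | zero => simp
  | add z z' h h' => simp only [map_add, LinearMap.add_apply, star_add, h, h']
  | tmul x y =>
    induction w using induction_on with
    | zero => simp
    | add w w' h h' => simp only [map_add, LinearMap.add_apply, star_add, h, h']
    | tmul x' y' =>
      rw [form_tmul, form_tmul, TensorProduct.star_tmul, CStarModule.star_inner,
        CStarModule.star_inner]

theorem form_act_right (d : A ⊗[ℂ] B) (z w : AlgTensor A B M N) :
    form A B M N z (act A B M N d w) = d * form A B M N z w := by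
  induction z using induction_on with
  | zero => simp
  | add z z' h h' => simp only [map_add, LinearMap.add_apply, mul_add, h, h']
  | tmul x y =>
    induction w using induction_on with
    | zero => simp
    | add w w' h h' => simp only [map_add, mul_add, h, h']
    | tmul x' y' =>
      induction d with
      | zero => simp
      | add d d' h h' => simp only [map_add, LinearMap.add_apply, add_mul, h, h']
      | tmul a b =>
        rw [act_tmul, form_tmul, form_tmul, Algebra.TensorProduct.tmul_mul_tmul,
          CStarModule.inner_op_smul_right, CStarModule.inner_op_smul_right]

theorem form_act_left (d : A ⊗[ℂ] B) (z w : AlgTensor A B M N) :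
    form A B M N (act A B M N d z) w = form A B M N z w * star d := by
  rw [← star_form, form_act_right, star_mul, star_form]

theorem tensorFunctional_form_nonneg (f : A →ₚ[ℂ] ℂ) (g : B →ₚ[ℂ] ℂ) (z : AlgTensor A B M N) :
    0 ≤ tensorFunctional f g (form A B M N z z) := by
  obtain ⟨H, _, _, κ, hκ⟩ := exists_innerProductSpace_of_form
    ((CStarModule.innerₛₗ (A := A) (E := M)).compr₂ₛₗ f.toLinearMap)
    (fun x y => by
      change star (f (inner A y x)) = f (inner A x y)
      rw [← map_star, CStarModule.star_inner])
    (fun x => f.map_nonneg CStarModule.inner_self_nonneg)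
  obtain ⟨K, _, _, μ, hμ⟩ := exists_innerProductSpace_of_form
    ((CStarModule.innerₛₗ (A := B) (E := N)).compr₂ₛₗ g.toLinearMap)
    (fun x y => by
      change star (g (inner B y x)) = g (inner B x y)
      rw [← map_star, CStarModule.star_inner])
    (fun x => g.map_nonneg CStarModule.inner_self_nonneg)
  let T : AlgTensor A B M N →ₗ[ℂ] H ⊗[ℂ] K := TensorProduct.map κ μ
  have h : ∀ z w, tensorFunctional f g (form A B M N z w) = ⟪T z, T w⟫_ℂ := by
    intro z w
    induction z using induction_on with
    | zero => simp
    | add z z' h h' => simp only [map_add, LinearMap.add_apply, _root_.inner_add_left, h, h']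
    | tmul x y =>
      induction w using induction_on with
      | zero => simp
      | add w w' h h' => simp only [map_add, _root_.inner_add_right, h, h']
      | tmul x' y' =>
        rw [form_tmul, tensorFunctional_tmul]
        change _ = ⟪κ x ⊗ₜ[ℂ] μ y, κ x' ⊗ₜ[ℂ] μ y'⟫_ℂ
        rw [TensorProduct.inner_tmul, hκ, hμ]
        rfl
  rw [h]
  exact RCLike.nonneg_iff.2 ⟨_root_.inner_self_nonneg (𝕜 := ℂ) (x := T z),
    _root_.inner_self_im (𝕜 := ℂ) (T z)⟩

/-- The `A ⊗ B`-valued semi-inner product on `M ⊙ N`. -/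
instance : Inner (MinTensor A B) (AlgTensor A B M N) where
  inner z w := MinTensor.ι A B (form A B M N z w)

theorem inner_def (z w : AlgTensor A B M N) :
    inner (MinTensor A B) z w = MinTensor.ι A B (form A B M N z w) := rfl

theorem inner_add_left (z z' w : AlgTensor A B M N) :
    inner (MinTensor A B) (z + z') w =
      inner (MinTensor A B) z w + inner (MinTensor A B) z' w := by
  simp only [inner_def, map_add, LinearMap.add_apply]

theorem inner_add_right (z w w' : AlgTensor A B M N) :
    inner (MinTensor A B) z (w + w') =
      inner (MinTensor A B) z w + inner (MinTensor A B) z w' := by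
  simp only [inner_def, map_add]

theorem inner_smul_left (c : ℂ) (z w : AlgTensor A B M N) :
    inner (MinTensor A B) (c • z) w = star c • inner (MinTensor A B) z w := by
  rw [inner_def, LinearMap.map_smulₛₗ₂, map_smul]
  rfl

theorem inner_smul_right (c : ℂ) (z w : AlgTensor A B M N) :
    inner (MinTensor A B) z (c • w) = c • inner (MinTensor A B) z w := by
  rw [inner_def, map_smul, map_smul, inner_def]

theorem inner_act_right (d : A ⊗[ℂ] B) (z w : AlgTensor A B M N) :
    inner (MinTensor A B) z (act A B M N d w) =
      MinTensor.ι A B d * inner (MinTensor A B) z w := by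
  rw [inner_def, form_act_right, map_mul, inner_def]

theorem inner_act_left (d : A ⊗[ℂ] B) (z w : AlgTensor A B M N) :
    inner (MinTensor A B) (act A B M N d z) w =
      inner (MinTensor A B) z w * star (MinTensor.ι A B d) := by
  rw [inner_def, form_act_left, map_mul, map_star, inner_def]

theorem inner_self_nonneg (z : AlgTensor A B M N) : 0 ≤ inner (MinTensor A B) z z := by
  refine MinTensor.ι_nonneg (star_form z z) fun f g t => ?_
  have h := tensorFunctional_form_nonneg f g (act A B M N (star t) z)
  rwa [form_act_right, form_act_left, star_star] at h

theorem star_inner (z w : AlgTensor A B M N) :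
    star (inner (MinTensor A B) z w) = inner (MinTensor A B) w z := by
  rw [inner_def, ← map_star, star_form]; rfl

/-- The seminorm `‖z‖ = ‖⟨z, z⟩‖ ^ (1 / 2)` on `M ⊙ N`. -/
instance : Norm (AlgTensor A B M N) where
  norm z := √‖inner (MinTensor A B) z z‖

theorem norm_def (z : AlgTensor A B M N) : ‖z‖ = √‖inner (MinTensor A B) z z‖ := rfl

theorem norm_sq (z : AlgTensor A B M N) : ‖z‖ ^ 2 = ‖inner (MinTensor A B) z z‖ :=
  Real.sq_sqrt (norm_nonneg _)

theorem norm_inner_le (z w : AlgTensor A B M N) :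
    ‖inner (MinTensor A B) z w‖ ≤ ‖z‖ * ‖w‖ := by
  have key : ∀ r : ℝ, ‖z‖ ^ 2 ≤ r → 0 < r →
      ‖inner (MinTensor A B) z w‖ ^ 2 ≤ r * ‖w‖ ^ 2 := by
    intro r hr hr0
    set d := form A B M N z w with hd
    set c := inner (MinTensor A B) z w with hc
    have hcd : MinTensor.ι A B d = c := rfl
    have hwz : inner (MinTensor A B) w z = star c := (star_inner z w).symm
    -- expand `0 ≤ ⟨d z - r w, d z - r w⟩`
    have h0 := inner_self_nonneg (act A B M N d z + (-r : ℂ) • w)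
    have h1 : inner (MinTensor A B) (act A B M N d z + (-r : ℂ) • w)
        (act A B M N d z + (-r : ℂ) • w) =
        c * inner (MinTensor A B) z z * star c - (2 * r) • (c * star c)
          + (r * r) • inner (MinTensor A B) w w := by
      have e : star (-r : ℂ) = -r := by simp
      simp only [inner_add_left, inner_add_right, inner_smul_left, inner_smul_right,
        inner_act_left, inner_act_right, hcd, hwz, ← hc, e]
      simp only [neg_smul, smul_neg, neg_neg, Complex.coe_smul, mul_smul, two_smul, mul_assoc,
        smul_add, mul_add, mul_neg, mul_smul_comm]
      abel
    have h2 : c * inner (MinTensor A B) z z * star c ≤ r • (c * star c) := by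
      refine (CStarAlgebra.star_right_conjugate_le_norm_smul
        (hb := star_inner z z)).trans ?_
      rw [← norm_sq]
      exact smul_le_smul_of_nonneg_right hr (mul_star_self_nonneg c)
    have h3 : r • (c * star c) ≤ (r * r) • inner (MinTensor A B) w w := by
      rw [h1] at h0
      have h4 : 0 ≤ r • (c * star c) - (2 * r) • (c * star c)
          + (r * r) • inner (MinTensor A B) w w := h0.trans (by gcongr)
      have h5 : r • (c * star c) - (2 * r) • (c * star c)
          + (r * r) • inner (MinTensor A B) w w =
          (r * r) • inner (MinTensor A B) w w - r • (c * star c) := by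
        rw [two_mul, add_smul]; abel
      rw [h5] at h4
      exact sub_nonneg.1 h4
    have h6 : c * star c ≤ r • inner (MinTensor A B) w w := by
      rw [mul_smul] at h3
      exact (smul_le_smul_iff_of_pos_left hr0).1 h3
    have h7 := CStarAlgebra.norm_le_norm_of_nonneg_of_le (mul_star_self_nonneg c) h6
    rw [CStarRing.norm_self_mul_star, norm_smul, Real.norm_of_nonneg hr0.le, ← norm_sq] at h7
    rw [sq]
    exact h7
  have hz : 0 ≤ ‖z‖ := Real.sqrt_nonneg _
  have hw : 0 ≤ ‖w‖ := Real.sqrt_nonneg _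
  have key2 : ‖inner (MinTensor A B) z w‖ ^ 2 ≤ ‖z‖ ^ 2 * ‖w‖ ^ 2 := by
    refine ge_of_tendsto (x := nhdsWithin (‖z‖ ^ 2) (Set.Ioi (‖z‖ ^ 2)))
      (f := fun r : ℝ => r * ‖w‖ ^ 2) ?_ ?_
    · exact ((continuous_id.mul continuous_const).tendsto _).mono_left nhdsWithin_le_nhds
    · filter_upwards [self_mem_nhdsWithin] with r hr
      exact key r (le_of_lt hr) (lt_of_le_of_lt (sq_nonneg _) hr)
  rw [← mul_pow] at key2
  exact (sq_le_sq₀ (norm_nonneg _) (mul_nonneg hz hw)).1 key2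

theorem core : SeminormedSpace.Core ℂ (AlgTensor A B M N) where
  norm_nonneg z := Real.sqrt_nonneg _
  norm_smul c z := by
    have h : inner (MinTensor A B) (c • z) (c • z) =
        (star c * c) • inner (MinTensor A B) z z := by
      rw [inner_smul_left, inner_smul_right, mul_smul]
    rw [norm_def, norm_def, h, norm_smul, CStarRing.norm_star_mul_self,
      Real.sqrt_mul (by positivity), Real.sqrt_mul_self (norm_nonneg c)]
  norm_triangle z w := by
    have hz : 0 ≤ ‖z‖ := Real.sqrt_nonneg _
    have hw : 0 ≤ ‖w‖ := Real.sqrt_nonneg _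
    refine (sq_le_sq₀ (Real.sqrt_nonneg _) (add_nonneg hz hw)).1 ?_
    have h : inner (MinTensor A B) (z + w) (z + w) = inner (MinTensor A B) z z +
        inner (MinTensor A B) z w + (inner (MinTensor A B) w z + inner (MinTensor A B) w w) := by
      rw [inner_add_left, inner_add_right, inner_add_right]
    calc ‖z + w‖ ^ 2 = ‖inner (MinTensor A B) (z + w) (z + w)‖ := norm_sq _
      _ ≤ ‖z‖ ^ 2 + ‖z‖ * ‖w‖ + (‖w‖ * ‖z‖ + ‖w‖ ^ 2) := by
          rw [h, norm_sq, norm_sq]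
          refine (norm_add_le _ _).trans (add_le_add ((norm_add_le _ _).trans ?_)
            ((norm_add_le _ _).trans ?_))
          · exact add_le_add le_rfl (norm_inner_le z w)
          · exact add_le_add (norm_inner_le w z) le_rfl
      _ = (‖z‖ + ‖w‖) ^ 2 := by ring

instance : SeminormedAddCommGroup (AlgTensor A B M N) := SeminormedAddCommGroup.ofCore core

instance : NormedSpace ℂ (AlgTensor A B M N) where
  norm_smul_le c z := (core.norm_smul c z).le

theorem norm_act_le (d : A ⊗[ℂ] B) (z : AlgTensor A B M N) :
    ‖act A B M N d z‖ ≤ ‖MinTensor.ι A B d‖ * ‖z‖ := by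
  rw [← sq_le_sq₀ (norm_nonneg _) (by positivity), norm_sq, mul_pow, norm_sq, inner_act_right,
    inner_act_left]
  refine (norm_mul_le _ _).trans ?_
  rw [sq, mul_assoc]
  gcongr
  refine (norm_mul_le _ _).trans ?_
  rw [norm_star, mul_comm]

end AlgTensor


/-- The external tensor product `M ⊗ N` of Hilbert modules: the completion of the algebraic tensor
product in the norm of its `A ⊗ B`-valued inner product. -/
def ExternalTensor : Type (max w w') := Completion (AlgTensor A B M N)

namespace ExternalTensor

instance : NormedAddCommGroup (ExternalTensor A B M N) :=
  inferInstanceAs (NormedAddCommGroup (Completion (AlgTensor A B M N)))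
instance : NormedSpace ℂ (ExternalTensor A B M N) :=
  inferInstanceAs (NormedSpace ℂ (Completion (AlgTensor A B M N)))
instance : CompleteSpace (ExternalTensor A B M N) :=
  inferInstanceAs (CompleteSpace (Completion (AlgTensor A B M N)))

/-- The canonical map `M ⊙ N → M ⊗ N`. -/
def incl : AlgTensor A B M N →ₗᵢ[ℂ] ExternalTensor A B M N := Completion.toComplₗᵢ

variable {A B M N}

@[elab_as_elim]
theorem induction_on {p : ExternalTensor A B M N → Prop} (x : ExternalTensor A B M N)
    (hp : IsClosed {x | p x}) (h : ∀ z, p (incl A B M N z)) : p x :=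
  Completion.induction_on x hp h

/-- The extension of a continuous map on `M ⊙ N` to `M ⊗ N`. -/
def extend {σ : ℂ →+* ℂ} {F : Type*} [NormedAddCommGroup F] [NormedSpace ℂ F] [CompleteSpace F]
    (S : AlgTensor A B M N →SL[σ] F) : ExternalTensor A B M N →SL[σ] F :=
  ContinuousLinearMap.fromCompletion S

@[simp]
theorem extend_incl {σ : ℂ →+* ℂ} {F : Type*} [NormedAddCommGroup F] [NormedSpace ℂ F]
    [CompleteSpace F] (S : AlgTensor A B M N →SL[σ] F) (z : AlgTensor A B M N) :
    extend S (incl A B M N z) = S z :=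
  ContinuousLinearMap.fromCompletion_apply_coe S z

theorem ext_incl {σ : ℂ →+* ℂ} {F : Type*} [NormedAddCommGroup F] [NormedSpace ℂ F]
    {S T : ExternalTensor A B M N →SL[σ] F}
    (h : ∀ z, S (incl A B M N z) = T (incl A B M N z)) : S = T := by
  ext x
  induction x using induction_on with
  | hp => exact isClosed_eq S.continuous T.continuous
  | h z => exact h z

variable (A B M N)

/-- The functional `⟨z, ·⟩` on `M ⊗ N`, for `z` in `M ⊙ N`. -/
def innerLeft (z : AlgTensor A B M N) : ExternalTensor A B M N →L[ℂ] MinTensor A B :=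
  extend <| LinearMap.mkContinuous
    ((MinTensor.ι A B : A ⊗[ℂ] B →ₗ[ℂ] MinTensor A B) ∘ₗ AlgTensor.form A B M N z) ‖z‖
    (AlgTensor.norm_inner_le z)

theorem innerLeft_incl (z w : AlgTensor A B M N) :
    innerLeft A B M N z (incl A B M N w) = inner (MinTensor A B) z w :=
  extend_incl (σ := RingHom.id ℂ) _ w

/-- The inner product on `M ⊗ N`, the continuous extension of the one on `M ⊙ N`. -/
def innerExt : ExternalTensor A B M N →L⋆[ℂ] ExternalTensor A B M N →L[ℂ] MinTensor A B :=
  extend <| LinearMap.mkContinuous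
    { toFun := innerLeft A B M N
      map_add' := fun z z' => ext_incl fun w => by
        rw [add_apply, innerLeft_incl, innerLeft_incl, innerLeft_incl, AlgTensor.inner_add_left]
      map_smul' := fun c z => ext_incl fun w => by
        rw [smul_apply, innerLeft_incl, innerLeft_incl, AlgTensor.inner_smul_left]
        rfl } 1 fun z => by
    refine ContinuousLinearMap.opNorm_le_bound _ (by positivity) fun x => ?_
    induction x using induction_on with
    | hp => exact isClosed_le (by fun_prop) (by fun_prop)
    | h w =>
      rw [one_mul, LinearIsometry.norm_map]
      exact (innerLeft_incl A B M N z w).symm ▸ AlgTensor.norm_inner_le z w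

/-- The action of `A ⊙ B` on `M ⊗ N`. -/
def actAlg : A ⊗[ℂ] B →ₗ[ℂ] ExternalTensor A B M N →L[ℂ] ExternalTensor A B M N where
  toFun d := extend <| (incl A B M N).toContinuousLinearMap ∘L
    (AlgTensor.act A B M N d).mkContinuous ‖MinTensor.ι A B d‖ (AlgTensor.norm_act_le d)
  map_add' d d' := ext_incl fun z => by simp
  map_smul' c d := ext_incl fun z => by simp

theorem actAlg_incl (d : A ⊗[ℂ] B) (z : AlgTensor A B M N) :
    actAlg A B M N d (incl A B M N z) = incl A B M N (AlgTensor.act A B M N d z) :=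
  extend_incl (σ := RingHom.id ℂ) _ z

theorem norm_actAlg_le (d : A ⊗[ℂ] B) : ‖actAlg A B M N d‖ ≤ 1 * ‖MinTensor.ι A B d‖ := by
  rw [one_mul]
  refine ContinuousLinearMap.opNorm_le_bound _ (norm_nonneg _) fun x => ?_
  induction x using induction_on with
  | hp => exact isClosed_le (by fun_prop) (by fun_prop)
  | h w =>
    rw [actAlg_incl, LinearIsometry.norm_map, LinearIsometry.norm_map]
    exact AlgTensor.norm_act_le d w

/-- The action of `A ⊗ B` on `M ⊗ N`, the continuous extension of the action of `A ⊙ B`. -/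
def actExt : MinTensor A B →L[ℂ] ExternalTensor A B M N →L[ℂ] ExternalTensor A B M N :=
  (actAlg A B M N).extendOfNorm (MinTensor.ι A B : A ⊗[ℂ] B →ₗ[ℂ] MinTensor A B)

instance : Inner (MinTensor A B) (ExternalTensor A B M N) where
  inner x y := innerExt A B M N x y

instance : SMul (MinTensor A B) (ExternalTensor A B M N) where
  smul c x := actExt A B M N c x

variable {A B M N}

theorem inner_def (x y : ExternalTensor A B M N) :
    inner (MinTensor A B) x y = innerExt A B M N x y := rfl

theorem smul_def (c : MinTensor A B) (x : ExternalTensor A B M N) :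
    c • x = actExt A B M N c x := rfl

theorem inner_incl (z w : AlgTensor A B M N) :
    inner (MinTensor A B) (incl A B M N z) (incl A B M N w) = inner (MinTensor A B) z w := by
  rw [inner_def, innerExt, extend_incl]
  exact innerLeft_incl A B M N z w

theorem smul_incl (d : A ⊗[ℂ] B) (z : AlgTensor A B M N) :
    MinTensor.ι A B d • incl A B M N z = incl A B M N (AlgTensor.act A B M N d z) := by
  have h : actExt A B M N (MinTensor.ι A B d) = actAlg A B M N d :=
    LinearMap.extendOfNorm_eq
      (e := (MinTensor.ι A B : A ⊗[ℂ] B →ₗ[ℂ] MinTensor A B)) (MinTensor.denseRange_ι A B)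
      ⟨1, norm_actAlg_le A B M N⟩ d
  rw [smul_def, h, actAlg_incl]

/-- `M ⊗ N` is a Hilbert module over `A ⊗ B`. -/
instance : CStarModule (MinTensor A B) (ExternalTensor A B M N) :=
  have hn : ∀ x : ExternalTensor A B M N, ‖x‖ = √‖inner (MinTensor A B) x x‖ := fun x => by
    induction x using induction_on with
    | hp =>
      simp only [inner_def]
      exact isClosed_eq (by fun_prop) (by fun_prop)
    | h z => rw [inner_incl, LinearIsometry.norm_map]; rfl
  { inner_add_right := by intros; simp only [inner_def, map_add]
    inner_self_nonneg := by
      intro x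
      induction x using induction_on with
      | hp =>
        simp only [inner_def]
        exact isClosed_le (by fun_prop) (by fun_prop)
      | h z => rw [inner_incl]; exact AlgTensor.inner_self_nonneg z
    inner_self := by
      intro x
      rw [← norm_eq_zero (a := x), hn, Real.sqrt_eq_zero (norm_nonneg _), norm_eq_zero]
    inner_op_smul_right := by
      intro c x y
      induction x using induction_on with
      | hp =>
        simp only [inner_def]
        exact isClosed_eq (by fun_prop) (by fun_prop)
      | h z =>
        induction y using induction_on with
        | hp =>
          simp only [inner_def, smul_def]
          exact isClosed_eq (by fun_prop) (by fun_prop)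
        | h w =>
          induction c using (MinTensor.denseRange_ι A B).induction_on with
          | hp =>
            simp only [inner_def, smul_def]
            exact isClosed_eq (by fun_prop) (by fun_prop)
          | ih d => rw [smul_incl, inner_incl, inner_incl, AlgTensor.inner_act_right]
    inner_smul_right_complex := by intros; simp only [inner_def, map_smul]
    star_inner := fun x y => by
      induction x using induction_on with
      | hp =>
        simp only [inner_def]
        exact isClosed_eq (by fun_prop) (by fun_prop)
      | h z =>
        induction y using induction_on with
        | hp =>
          simp only [inner_def]
          exact isClosed_eq (by fun_prop) (by fun_prop)
        | h w => rw [inner_incl, inner_incl, AlgTensor.star_inner]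
    norm_eq_sqrt_norm_inner_self := hn }

variable (A B) in
/-- The elementary tensor `x ⊗ y` in `M ⊗ N`. -/
def tmul (x : M) (y : N) : ExternalTensor A B M N := incl A B M N (AlgTensor.tmul x y)

theorem inner_tmul (x x' : M) (y y' : N) :
    inner (MinTensor A B) (tmul A B x y) (tmul A B x' y') =
      MinTensor.ι A B (inner A x x' ⊗ₜ inner B y y') :=
  inner_incl _ _

theorem smul_tmul (a : A) (b : B) (x : M) (y : N) :
    MinTensor.ι A B (a ⊗ₜ b) • tmul A B x y = tmul A B (a • x) (b • y) :=
  smul_incl _ _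

end ExternalTensor

end ExternalTensor

section CompactContainment

universe w

namespace HilbertModule

variable (A : Type u) {E : Type w} [NonUnitalCStarAlgebra A] [PartialOrder A] [StarOrderedRing A]
  [NormedAddCommGroup E] [NormedSpace ℂ E] [SMul A E] [CStarModule A E]

/-- The operator `z ↦ x ⟨y, z⟩`. (In `CStarModule` the action of `A` is written on the left,
`⟨x, a • y⟩ = a * ⟨x, y⟩`.) -/
def rankOne (x y : E) : E →L[ℂ] E :=
  LinearMap.mkContinuous
    ((act (A := A) (M := E)).flip x ∘ₗ CStarModule.innerₛₗ (A := A) (E := E) y) (‖y‖ * ‖x‖)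
    fun z => by
      change ‖inner A y z • x‖ ≤ _
      refine (norm_smul_le _ _).trans ?_
      rw [mul_right_comm]
      gcongr
      exact CStarModule.norm_inner_le E

theorem rankOne_apply (x y z : E) : rankOne A x y z = inner A y z • x := rfl

/-- The compact endomorphisms of a Hilbert `A`-module: the norm closure of the linear span of the
operators `z ↦ x ⟨y, z⟩`. -/
def IsCompactEndomorphism (b : E →L[ℂ] E) : Prop :=
  b ∈ closure (Submodule.span ℂ {T | ∃ x y : E, T = rankOne A x y} : Set (E →L[ℂ] E))

/-- Self-adjointness with respect to the `A`-valued inner product. -/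
def IsSelfAdjointEndomorphism (b : E →L[ℂ] E) : Prop :=
  ∀ x y : E, inner A (b x) y = inner A x (b y)

/-- `X` is a closed `A`-submodule of `E`, hence a Hilbert `A`-module itself. -/
structure IsHilbertSubmodule (X : Submodule ℂ E) : Prop where
  isClosed : IsClosed (X : Set E)
  smul_mem : ∀ (a : A), ∀ x ∈ X, a • x ∈ X

/-- `X` is countably generated: for some countable `s ⊆ X`, the linear span of the elements
`a • x` with `a` in `A` and `x` in `s` is dense in `X`. -/
def IsCountablyGenerated (X : Submodule ℂ E) : Prop :=
  ∃ s : Set E, s.Countable ∧ s ⊆ X ∧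
    (X : Set E) ⊆ closure (Submodule.span ℂ {z | ∃ a : A, ∃ x ∈ s, z = a • x} : Set E)

/-- `X ⊂⊂ E` for a closed submodule `X` of a Hilbert `A`-module `E`, both countably generated:
some compact self-adjoint endomorphism of `E` acts as the identity on `X`. -/
def IsCompactlyContained (X : Submodule ℂ E) : Prop :=
  IsHilbertSubmodule A X ∧ IsCountablyGenerated A X ∧ IsCountablyGenerated A (⊤ : Submodule ℂ E) ∧
    ∃ b : E →L[ℂ] E, IsCompactEndomorphism A b ∧ IsSelfAdjointEndomorphism A b ∧
      ∀ x ∈ X, b x = x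

/-- The Hilbert `A`-module `E` is a compact element: `E ⊂⊂ E`. -/
def IsCompactElement (A : Type u) (E : Type w) [NonUnitalCStarAlgebra A] [PartialOrder A]
    [StarOrderedRing A] [NormedAddCommGroup E] [NormedSpace ℂ E] [SMul A E] [CStarModule A E] :
    Prop :=
  IsCompactlyContained A (⊤ : Submodule ℂ E)

end HilbertModule

end CompactContainment

end

/-! When the submodule is all of `E`, the operator `b` in the definition fixes every vector, so it
is the identity; being a compact element therefore makes the identity of `E` a compact endomorphism.
Compactness of the identity improves to finite rank (`HilbertModule.one_mem_finiteRank`): some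
finite-rank `F` satisfies `‖1 - F‖ < 1`, hence is invertible, and finite-rank operators absorb
`A`-linear operators on the left, so `1 = F⁻¹ * F` has finite rank. In other words `E` has a finite
reconstruction formula `z = ∑ ⟨y i, z⟩ • x i`.

Such formulas multiply. If `x = ∑ ⟨v i, x⟩ • u i` on `M₁` and `y = ∑ ⟨v' j, y⟩ • u' j` on `M₂`, then
the finite-rank operator built from the pairs `u i ⊗ u' j` and `v i ⊗ v' j` fixes every elementary
tensor `x ⊗ y` (`exists_finiteRank_tmul`), and by linearity and density it is the identity of `M₁ ⊗
M₂`.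

Conversely, a module whose identity has finite rank is finitely generated, and its identity serves
as the required compact self-adjoint endomorphism (`isCompactElement_of_one_mem_finiteRank`). -/

open scoped TensorProduct

namespace HilbertModule

/-! ### Compact elements are the Hilbert modules whose identity has finite rank. -/

section Frames

variable (A : Type*) {E : Type*} [NonUnitalCStarAlgebra A] [PartialOrder A] [StarOrderedRing A]
  [NormedAddCommGroup E] [NormedSpace ℂ E] [SMul A E] [CStarModule A E]

/-- The action of `A` is a bare `SMul`, so the module laws are not axioms here. They follow from
nondegeneracy of the inner product, since `⟨z, a • x⟩ = a * ⟨z, x⟩`. -/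
theorem mul_smul_assoc (a b : A) (x : E) : (a * b) • x = a • b • x :=
  ext_inner A fun z => by simp [mul_assoc]

theorem act_smul_add (a : A) (x y : E) : a • (x + y) = a • x + a • y :=
  map_add (act (A := A) (M := E) a) x y

theorem act_smul_zero (a : A) : a • (0 : E) = 0 :=
  map_zero (act (A := A) (M := E) a)

theorem smul_smul_complex_comm (a : A) (c : ℂ) (x : E) : a • c • x = c • a • x :=
  map_smul (act (A := A) (M := E) a) c x

variable (E) in
/-- The finite-rank endomorphisms: the linear span of the operators `z ↦ x ⟨y, z⟩`. -/
def finiteRank : Submodule ℂ (E →L[ℂ] E) :=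
  Submodule.span ℂ {T | ∃ x y : E, T = rankOne A x y}

variable {A}

/-- Elements of `E →L[ℂ] E` are only `ℂ`-linear by type. For finite-rank operators `A`-linearity
comes from that of `⟨y, ·⟩`, and it will pass to their inverses. -/
theorem finiteRank_apply_smul {F : E →L[ℂ] E} (hF : F ∈ finiteRank A E) (a : A) (z : E) :
    F (a • z) = a • F z := by
  induction hF using Submodule.span_induction with
  | mem T hT =>
    obtain ⟨x, y, rfl⟩ := hT
    rw [rankOne_apply, rankOne_apply, CStarModule.inner_op_smul_right, mul_smul_assoc]
  | zero => exact (act_smul_zero A a).symm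
  | add S T _ _ hS hT => rw [add_apply, add_apply, hS, hT, act_smul_add]
  | smul c T _ hT => rw [smul_apply, smul_apply, hT, smul_smul_complex_comm]

/-- On generators, `G` composed with `z ↦ ⟨y, z⟩ • x` is `z ↦ ⟨y, z⟩ • G x`. Only `A`-linearity of
`G` enters, so no adjoint of `G` has to be found. -/
theorem mul_mem_finiteRank {G F : E →L[ℂ] E} (hG : ∀ (a : A) (z : E), G (a • z) = a • G z)
    (hF : F ∈ finiteRank A E) : G * F ∈ finiteRank A E := by
  induction hF using Submodule.span_induction with
  | mem T hT =>
    obtain ⟨x, y, rfl⟩ := hT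
    refine Submodule.subset_span ⟨G x, y, ?_⟩
    ext z
    exact hG _ _
  | zero => rw [mul_zero]; exact zero_mem _
  | add S T _ _ hS hT => rw [mul_add]; exact add_mem hS hT
  | smul c T _ hT => rw [mul_smul_comm]; exact Submodule.smul_mem _ c hT

/-- If the identity is compact, then it has finite rank. -/
theorem one_mem_finiteRank [CompleteSpace E] (h : IsCompactEndomorphism A (1 : E →L[ℂ] E)) :
    (1 : E →L[ℂ] E) ∈ finiteRank A E := by
  obtain ⟨F, hF, hF1⟩ := Metric.mem_closure_iff.1 h 1 one_pos
  -- Neumann series: `F = 1 - (1 - F)` with `‖1 - F‖ < 1`, in the algebra `E →L[ℂ] E`, which is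
  -- complete because `E` is.
  obtain ⟨u, rfl⟩ : IsUnit F := by
    have := (Units.oneSub (1 - F) (by rwa [← dist_eq_norm])).isUnit
    rwa [Units.val_oneSub, sub_sub_cancel] at this
  have hinv : ∀ w, (u : E →L[ℂ] E) ((↑u⁻¹ : E →L[ℂ] E) w) = w := fun w =>
    congrArg (fun T : E →L[ℂ] E => T w) u.mul_inv
  have hinv' : ∀ w, (↑u⁻¹ : E →L[ℂ] E) ((u : E →L[ℂ] E) w) = w := fun w =>
    congrArg (fun T : E →L[ℂ] E => T w) u.inv_mul
  rw [← u.inv_mul]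
  refine mul_mem_finiteRank (fun a z => ?_) hF
  -- The inverse inherits `A`-linearity: `u⁻¹ (a • z) = u⁻¹ (a • u (u⁻¹ z)) = u⁻¹ (u (a • u⁻¹ z)) =
  -- a • u⁻¹ z`.
  conv_lhs => rw [← hinv z, ← finiteRank_apply_smul hF, hinv']

/-- Each generator `z ↦ ⟨y, z⟩ • x` takes its values in the multiples of the single vector `x`. For
`F = 1` this yields a finite generating set of `E`, with no closure needed. -/
theorem exists_finite_range_subset_span {F : E →L[ℂ] E} (hF : F ∈ finiteRank A E) :
    ∃ s : Set E, s.Finite ∧ ∀ z, F z ∈ Submodule.span ℂ {z | ∃ a : A, ∃ x ∈ s, z = a • x} := by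
  induction hF using Submodule.span_induction with
  | mem T hT =>
    obtain ⟨x, y, rfl⟩ := hT
    exact ⟨{x}, Set.finite_singleton x, fun z => Submodule.subset_span ⟨inner A y z, x, rfl, rfl⟩⟩
  | zero => exact ⟨∅, Set.finite_empty, fun z => zero_mem _⟩
  | add S T _ _ hS hT =>
    obtain ⟨s, hs, hS⟩ := hS
    obtain ⟨t, ht, hT⟩ := hT
    refine ⟨s ∪ t, hs.union ht, fun z => add_mem (Submodule.span_mono ?_ (hS z))
      (Submodule.span_mono ?_ (hT z))⟩
    · rintro _ ⟨a, x, hx, rfl⟩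
      exact ⟨a, x, Or.inl hx, rfl⟩
    · rintro _ ⟨a, x, hx, rfl⟩
      exact ⟨a, x, Or.inr hx, rfl⟩
  | smul c T _ hT =>
    obtain ⟨s, hs, hT⟩ := hT
    exact ⟨s, hs, fun z => Submodule.smul_mem _ c (hT z)⟩

theorem IsCompactElement.one_mem_finiteRank [CompleteSpace E] (h : IsCompactElement A E) :
    (1 : E →L[ℂ] E) ∈ finiteRank A E := by
  obtain ⟨-, -, -, b, hb, -, hb1⟩ := h
  obtain rfl : b = 1 := ContinuousLinearMap.ext fun x => hb1 x trivial
  exact HilbertModule.one_mem_finiteRank hb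

/-- A Hilbert module whose identity has finite rank is a compact element. -/
theorem isCompactElement_of_one_mem_finiteRank (h : (1 : E →L[ℂ] E) ∈ finiteRank A E) :
    IsCompactElement A E := by
  obtain ⟨s, hs, hspan⟩ := exists_finite_range_subset_span h
  have hgen : IsCountablyGenerated A (⊤ : Submodule ℂ E) :=
    ⟨s, hs.countable, fun _ _ => trivial, fun z _ => subset_closure (hspan z)⟩
  -- The submodule is `⊤`, so one proof of countable generation serves both it and `E`; the witness
  -- `b` is the identity.
  exact ⟨⟨isClosed_univ, fun _ _ _ => trivial⟩, hgen, hgen, 1, subset_closure h,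
    fun _ _ => rfl, fun _ _ => rfl⟩

end Frames

end HilbertModule

/-! ### Finite-rank operators on the external tensor product. -/

namespace ExternalTensor

open HilbertModule

variable {A B M N : Type*}
  [NonUnitalCStarAlgebra A] [PartialOrder A] [StarOrderedRing A]
  [NonUnitalCStarAlgebra B] [PartialOrder B] [StarOrderedRing B]
  [NormedAddCommGroup M] [NormedSpace ℂ M] [SMul A M] [CStarModule A M]
  [NormedAddCommGroup N] [NormedSpace ℂ N] [SMul B N] [CStarModule B N]

variable (A B M N) in
/-- `(x, y) ↦ x ⊗ y` as a bilinear map. -/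
noncomputable def tmulₗ : M →ₗ[ℂ] N →ₗ[ℂ] ExternalTensor A B M N :=
  (TensorProduct.mk ℂ M N).compr₂ (incl A B M N).toLinearMap

theorem tmulₗ_apply (x : M) (y : N) : tmulₗ A B M N x y = tmul A B x y := rfl

/-- Elementary tensors span a dense subspace, and bounded operators are determined there. -/
theorem ext_tmul {S T : ExternalTensor A B M N →L[ℂ] ExternalTensor A B M N}
    (h : ∀ x y, S (tmul A B x y) = T (tmul A B x y)) : S = T :=
  ext_incl fun z => by
    induction z using AlgTensor.induction_on with
    | zero => simp
    | tmul x y => exact h x y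
    | add z w hz hw => simp only [map_add, hz, hw]

/-- The operator `T` plays the role of `F ⊗ G`. Asserting only its existence avoids bounding a
tensor product of general operators: `T` is written down for generators, where it is again a
generator, and the condition on `T` is preserved under linear combinations in `F` and in `G`. -/
theorem exists_finiteRank_tmul {F : M →L[ℂ] M} {G : N →L[ℂ] N} (hF : F ∈ finiteRank A M)
    (hG : G ∈ finiteRank B N) :
    ∃ T ∈ finiteRank (MinTensor A B) (ExternalTensor A B M N),
      ∀ x y, T (tmul A B x y) = tmul A B (F x) (G y) := by
  -- The bundled bilinear form of `⊗` lets `simp` expand sums and scalars in either factor.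
  simp only [← tmulₗ_apply]
  induction hF using Submodule.span_induction with
  | zero => exact ⟨0, zero_mem _, fun x y => by simp⟩
  | add S T _ _ hS hT =>
    obtain ⟨S', hS', hS⟩ := hS
    obtain ⟨T', hT', hT⟩ := hT
    exact ⟨S' + T', add_mem hS' hT', fun x y => by simp [hS, hT]⟩
  | smul c T _ hT =>
    obtain ⟨T', hT', hT⟩ := hT
    exact ⟨c • T', Submodule.smul_mem _ c hT', fun x y => by simp [hT]⟩
  | mem T hT =>
    obtain ⟨u, v, rfl⟩ := hT
    induction hG using Submodule.span_induction with
    | zero => exact ⟨0, zero_mem _, fun x y => by simp⟩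
    | add S T _ _ hS hT =>
      obtain ⟨S', hS', hS⟩ := hS
      obtain ⟨T', hT', hT⟩ := hT
      exact ⟨S' + T', add_mem hS' hT', fun x y => by simp [hS, hT]⟩
    | smul c T _ hT =>
      obtain ⟨T', hT', hT⟩ := hT
      exact ⟨c • T', Submodule.smul_mem _ c hT', fun x y => by simp [hT]⟩
    | mem T hT =>
      obtain ⟨u', v', rfl⟩ := hT
      refine ⟨rankOne (MinTensor A B) (tmul A B u u') (tmul A B v v'),
        Submodule.subset_span ⟨_, _, rfl⟩, fun x y => ?_⟩
      -- Inner product and action both factor through elementary tensors: `⟨v ⊗ v', x ⊗ y⟩ • (u ⊗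
      -- u') = (⟨v, x⟩ • u) ⊗ (⟨v', y⟩ • u')`.
      rw [tmulₗ_apply, tmulₗ_apply, rankOne_apply, inner_tmul, smul_tmul, rankOne_apply,
        rankOne_apply]

theorem one_mem_finiteRank (h₁ : (1 : M →L[ℂ] M) ∈ finiteRank A M)
    (h₂ : (1 : N →L[ℂ] N) ∈ finiteRank B N) :
    (1 : ExternalTensor A B M N →L[ℂ] ExternalTensor A B M N) ∈
      finiteRank (MinTensor A B) (ExternalTensor A B M N) := by
  obtain ⟨T, hT, h⟩ := exists_finiteRank_tmul h₁ h₂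
  -- With both factors the identity, `h` says that `T` fixes every elementary tensor.
  obtain rfl : T = 1 := ext_tmul h
  exact hT

end ExternalTensor

theorem corollary4p1 {A B M₁ M₂ : Type*}
    [NonUnitalCStarAlgebra A] [PartialOrder A] [StarOrderedRing A]
    [NonUnitalCStarAlgebra B] [PartialOrder B] [StarOrderedRing B]
    [NormedAddCommGroup M₁] [NormedSpace ℂ M₁] [CompleteSpace M₁] [SMul A M₁] [CStarModule A M₁]
    [NormedAddCommGroup M₂] [NormedSpace ℂ M₂] [CompleteSpace M₂] [SMul B M₂] [CStarModule B M₂]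
    (h₁ : HilbertModule.IsCompactElement A M₁) (h₂ : HilbertModule.IsCompactElement B M₂) :
    HilbertModule.IsCompactElement (MinTensor A B) (ExternalTensor A B M₁ M₂) :=
  HilbertModule.isCompactElement_of_one_mem_finiteRank
    (ExternalTensor.one_mem_finiteRank h₁.one_mem_finiteRank h₂.one_mem_finiteRank)
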